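/- Let $0<a<b<\infty$ and let $c,\rho,g$ be smooth real-valued functions on $[a,b]$ with $c,\rho>0$; let $\kappa,\sigma>0$ be constants. Assume adiabatic equilibrium: $N^2:=-g\left(\frac{g}{c^2}+\frac{\rho'}{\rho}\right)=0$ on $[a,b]$. Put $h=r^2\rho/c^2$ and, for $\zeta>0$ (replacing $\Lambda_\ell=\ell(\ell+1)$ by $\zeta^2$), $$\mathcal J_\zeta[\eta]=(r^2\rho\,\eta')'-\Big(\zeta^2-\sigma^2\frac{r^2}{c^2}\Big)\rho\,\eta,\qquad \mathcal L_\zeta[\Phi]=(r^2\Phi')'-(\zeta^2-\kappa h)\Phi .$$ For an operator $\mathfrak L[w]=(pw')'+qw$ and $\vec\theta=(\theta_1,\theta_2)$ with $0\le\theta_1<\pi$, $0<\theta_2\le\pi$, let $\mathfrak S_{\mathfrak L}(\vec\theta)$ denote the boundary conditions $$-\cos\theta_1\,w(a)+p(a)\sin\theta_1\,w'(a)=0,\qquad -\cos\theta_2\,w(b)+p(b)\sin\theta_2\,w'(b)=0 .$$ Fix $\vec\theta,\vec\vartheta$ in this range. Then there is a function $\mathfrak z(\zeta)=\zeta^{-2}(1+o(1))$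 as $\zeta\to\infty$ (not depending on $\eta_0$ below) such that, for all sufficiently large $\zeta$, the operator $\mathcal J_\zeta$ under $\mathfrak S_{\mathcal J}(\vec\vartheta)$ has a Green's function, with Green's operator denoted $\mathfrak J_\zeta$, and for every $\eta_0\in\ker\mathcal J_\zeta$ (that is, every $\eta_0\in C^2([a,b])$ with $\mathcal J_\zeta[\eta_0]=0$, without boundary conditions) there is a solution $\Phi\in C^2([a,b])$ of the integro-differential equation $$\mathcal L_\zeta[\Phi]=\sigma^2\kappa h\,\big(\mathfrak J_\zeta[h\Phi]+\eta_0\big)\quad\text{on }[a,b]$$ with the following properties. (i) $\Phi$ satisfies $\mathfrak S_{\mathcal L}(\vec\theta)$, and $\eta_p:=\mathfrak J_\zeta[h\Phi]$ is in $C^2([a,b])$, satisfies $\mathcal J_\zeta[\eta_p]=h\Phi$ and satisfies $\mathfrak S_{\mathcal J}(\vec\vartheta)$. (ii) In the norm of $L^2([a,b])$, $\ \|\Phi\|\le\mathfrak z(\zeta)\,\|\sigma^2\kappa h\,\eta_0\|$. -/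

import Mathlib

open Set Filter Topology
open scoped ContDiff

noncomputable section

/-- The Sturm-Liouville expression `(p w')' + q w` on the interval `I`
(one-sided derivatives at the end points of `I`). -/
def slOp (p q : ℝ → ℝ) (I : Set ℝ) (w : ℝ → ℝ) (r : ℝ) : ℝ :=
  derivWithin (fun s => p s * derivWithin w I s) I r + q r * w r

/-- The separated self-adjoint boundary conditions on `[a, b]` with angles `θ = (θ₁, θ₂)`:
`-cos θ₁ w(a) + p(a) sin θ₁ w'(a) = 0` and `-cos θ₂ w(b) + p(b) sin θ₂ w'(b) = 0`. -/
def SLBoundary (p : ℝ → ℝ) (a b : ℝ) (θ : ℝ × ℝ) (w : ℝ → ℝ) : Prop :=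
  -Real.cos θ.1 * w a + p a * Real.sin θ.1 * derivWithin w (Icc a b) a = 0 ∧
  -Real.cos θ.2 * w b + p b * Real.sin θ.2 * derivWithin w (Icc a b) b = 0

/-- The admissible angles: `0 ≤ θ₁ < π` and `0 < θ₂ ≤ π`. -/
def AdmissibleAngles (θ : ℝ × ℝ) : Prop :=
  0 ≤ θ.1 ∧ θ.1 < Real.pi ∧ 0 < θ.2 ∧ θ.2 ≤ Real.pi

/-- `G` is the Green's function on `[a, b]` of `w ↦ (p w')' + q w` under the boundary conditions
with angles `θ`: it is continuous on the square; for every interior pole `t`, the function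
`G(·, t)` satisfies the boundary conditions and solves the homogeneous equation on both sides of
`t`, and its derivative jumps by `1 / p(t)` at `t`. -/
structure IsGreenFunction (p q : ℝ → ℝ) (a b : ℝ) (θ : ℝ × ℝ) (G : ℝ → ℝ → ℝ) : Prop where
  continuousOn : ContinuousOn (fun x : ℝ × ℝ => G x.1 x.2) (Icc a b ×ˢ Icc a b)
  boundary : ∀ t ∈ Ioo a b, SLBoundary p a b θ (fun r => G r t)
  contDiffOn_left : ∀ t ∈ Ioo a b, ContDiffOn ℝ 2 (fun r => G r t) (Icc a t)
  contDiffOn_right : ∀ t ∈ Ioo a b, ContDiffOn ℝ 2 (fun r => G r t) (Icc t b)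
  eq_left : ∀ t ∈ Ioo a b, ∀ r ∈ Icc a t, slOp p q (Icc a t) (fun s => G s t) r = 0
  eq_right : ∀ t ∈ Ioo a b, ∀ r ∈ Icc t b, slOp p q (Icc t b) (fun s => G s t) r = 0
  jump : ∀ t ∈ Ioo a b,
    derivWithin (fun r => G r t) (Icc t b) t - derivWithin (fun r => G r t) (Icc a t) t = 1 / p t

/-- The integral operator on `[a, b]` with kernel `G`. -/
def kernelOp (a b : ℝ) (G : ℝ → ℝ → ℝ) (f : ℝ → ℝ) (r : ℝ) : ℝ :=
  ∫ t in a..b, G r t * f t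

/-- The `L²([a, b])` norm (used for continuous functions only). -/
def l2Norm (a b : ℝ) (f : ℝ → ℝ) : ℝ :=
  Real.sqrt (∫ r in a..b, f r ^ 2)

/-- The data of the pulsation equations on `[a, b]`: sound speed `c`, density `ρ`, gravitational
acceleration `g`, the gravitational constant `κ` of the Poisson equation, and the frequency `σ`. -/
structure StellarModel where
  a : ℝ
  b : ℝ
  c : ℝ → ℝ
  ρ : ℝ → ℝ
  g : ℝ → ℝ
  κ : ℝ
  σ : ℝ
  a_pos : 0 < a
  a_lt_b : a < b
  c_smooth : ContDiffOn ℝ ∞ c (Icc a b)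
  ρ_smooth : ContDiffOn ℝ ∞ ρ (Icc a b)
  g_smooth : ContDiffOn ℝ ∞ g (Icc a b)
  c_pos : ∀ r ∈ Icc a b, 0 < c r
  ρ_pos : ∀ r ∈ Icc a b, 0 < ρ r
  κ_pos : 0 < κ
  σ_pos : 0 < σ

namespace StellarModel

/-- The squared Brunt-Väisälä frequency `N² = -g (g / c² + ρ' / ρ)`. -/
def Nsq (M : StellarModel) (r : ℝ) : ℝ :=
  -M.g r * (M.g r / M.c r ^ 2 + derivWithin M.ρ (Icc M.a M.b) r / M.ρ r)

/-- Adiabatic (isentropic) equilibrium: `N² = 0` on `[a, b]`. -/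
def AdiabaticEquilibrium (M : StellarModel) : Prop :=
  ∀ r ∈ Icc M.a M.b, M.Nsq r = 0

/-- `h = r² ρ / c²`. -/
def h (M : StellarModel) (r : ℝ) : ℝ := r ^ 2 * M.ρ r / M.c r ^ 2

/-- Leading coefficient `r² ρ` of `J`. -/
def pJ (M : StellarModel) (r : ℝ) : ℝ := r ^ 2 * M.ρ r

/-- Zeroth-order coefficient `-(Λ - σ² r² / c²) ρ` of `J`, with `Λ = ζ²`. -/
def qJ (M : StellarModel) (ζ r : ℝ) : ℝ :=
  -(ζ ^ 2 - M.σ ^ 2 * (r ^ 2 / M.c r ^ 2)) * M.ρ r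

/-- `J_ζ[η] = (r² ρ η')' - (ζ² - σ² r² / c²) ρ η`. -/
def J (M : StellarModel) (ζ : ℝ) (η : ℝ → ℝ) (r : ℝ) : ℝ :=
  slOp M.pJ (M.qJ ζ) (Icc M.a M.b) η r

/-- Leading coefficient `r²` of `L`. -/
def pL (r : ℝ) : ℝ := r ^ 2

/-- Zeroth-order coefficient `-(Λ - κ h)` of `L`, with `Λ = ζ²`. -/
def qL (M : StellarModel) (ζ r : ℝ) : ℝ := -(ζ ^ 2 - M.κ * M.h r)

/-- `L_ζ[Φ] = (r² Φ')' - (ζ² - κ h) Φ`. -/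
def L (M : StellarModel) (ζ : ℝ) (Φ : ℝ → ℝ) (r : ℝ) : ℝ :=
  slOp pL (M.qL ζ) (Icc M.a M.b) Φ r

/-- `ker J_ζ`: the `C²` solutions of `J_ζ[η] = 0` on `[a, b]` (no boundary conditions). -/
def kerJ (M : StellarModel) (ζ : ℝ) : Set (ℝ → ℝ) :=
  {η | ContDiffOn ℝ 2 η (Icc M.a M.b) ∧ ∀ r ∈ Icc M.a M.b, M.J ζ η r = 0}

/-- `η_p`, the image of `h Φ` under the Green's operator with kernel `G`. -/
def etaP (M : StellarModel) (G : ℝ → ℝ → ℝ) (Φ : ℝ → ℝ) : ℝ → ℝ :=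
  kernelOp M.a M.b G (fun t => M.h t * Φ t)

/-- The source term `σ² κ h η₀` of the integro-differential equation. -/
def source (M : StellarModel) (η₀ : ℝ → ℝ) (r : ℝ) : ℝ :=
  M.σ ^ 2 * M.κ * M.h r * η₀ r

/-- `Φ` is a `C²` solution on `[a, b]` of the integro-differential equation
`L_ζ[Φ] = σ² κ h (η_p + η₀)`, where `η_p` is the Green's operator with kernel `G` at `h Φ`. -/
def IsSolution (M : StellarModel) (ζ : ℝ) (G : ℝ → ℝ → ℝ) (η₀ Φ : ℝ → ℝ) : Prop :=
  ContDiffOn ℝ 2 Φ (Icc M.a M.b) ∧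
  ∀ r ∈ Icc M.a M.b,
    M.L ζ Φ r = M.σ ^ 2 * M.κ * M.h r * M.etaP G Φ r + M.source η₀ r

end StellarModel

end

/-! The nonlocal equation is traded for a local one. With `η` kept as a second unknown, `Φ` solves
the integro-differential problem as soon as `(Φ, η)` solves two Sturm-Liouville equations, coupled
through their right-hand sides, each under its own separated conditions. This is a linear two-point
problem in `ℝ⁴`, so by `exists_solvesLinearODE_boundary` uniqueness gives existence. Green's
representation `IsAdaptedPair.kernelOp_greenKernel_eq` then identifies `η` with `𝔍_ζ[hΦ]`, and no
fixed point argument is needed.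

Uniqueness and the norm bound both come from `IsSLPair.energy_estimate`: if `q ≤ -μ`, then `-∫ f w ≥
(μ - C) ∫ w²`, where `C` depends on neither `μ` nor `q`. For `L` one may take `μ = ζ² - O(1)`; for
`J` the constant `μ` grows like `ζ²` times the minimum of `ρ`, so for large `ζ` the norm of `η` is
at most a fixed multiple of that of `Φ`. Hence the coupling costs only a bounded amount, and `(ζ² -
C) ∫ Φ² ≤ -∫ S Φ` with a new constant `C` and `S` the source. This gives `‖Φ‖ ≤ (ζ² - C)⁻¹ ‖S‖`, and
`(ζ² - C)⁻¹ = ζ⁻²(1 + o(1))`. -/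

/-! ### Linear systems: global existence and the Fredholm alternative -/

/-- Componentwise truncation of a vector to the cube `[-R, R]^ι`. -/
def clampCube {ι : Type*} (R : ℝ) (x : ι → ℝ) : ι → ℝ := fun i => max (-R) (min R (x i))

theorem lipschitzWith_clampCube {ι : Type*} [Fintype ι] (R : ℝ) :
    LipschitzWith 1 (clampCube (ι := ι) R) := by
  refine LipschitzWith.of_dist_le_mul fun x y => ?_
  rw [NNReal.coe_one, one_mul, dist_pi_le_iff dist_nonneg]
  intro i
  refine le_trans ?_ (dist_le_pi_dist x y i)
  have h := ((LipschitzWith.id (α := ℝ)).const_min R).const_max (-R)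
  simpa [clampCube] using h.dist_le_mul (x i) (y i)

theorem norm_clampCube_le {ι : Type*} [Fintype ι] {R : ℝ} (hR : 0 ≤ R) (x : ι → ℝ) :
    ‖clampCube R x‖ ≤ R := by
  rw [pi_norm_le_iff_of_nonneg hR]
  intro i
  rw [Real.norm_eq_abs, abs_le]
  exact ⟨le_max_left _ _, max_le (by linarith) (min_le_left _ _)⟩

theorem clampCube_eq_self {ι : Type*} [Fintype ι] {R : ℝ} {x : ι → ℝ} (hx : ‖x‖ ≤ R) :
    clampCube R x = x := by
  funext i
  have h := abs_le.1 ((norm_le_pi_norm x i).trans hx)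
  simp [clampCube, h.1, h.2]

theorem norm_clampCube_le_norm {ι : Type*} [Fintype ι] {R : ℝ} (hR : 0 ≤ R) (x : ι → ℝ) :
    ‖clampCube R x‖ ≤ ‖x‖ := by
  have h := (lipschitzWith_clampCube (ι := ι) R).dist_le_mul x 0
  have h0 : clampCube R (0 : ι → ℝ) = 0 := clampCube_eq_self (by simpa using hR)
  simpa [h0] using h

/-- A family of linear endomorphisms of `ℝ^ι` that is pointwise continuous on a compact interval is
bounded there. -/
theorem exists_bound_linearMap_family {ι : Type*} [Fintype ι] [DecidableEq ι] {a b : ℝ}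
    {A : ℝ → (ι → ℝ) →ₗ[ℝ] (ι → ℝ)} (hA : ∀ x, ContinuousOn (fun t => A t x) (Icc a b)) :
    ∃ K : NNReal, ∀ t ∈ Icc a b, ∀ x, ‖A t x‖ ≤ K * ‖x‖ := by
  choose C hC using fun i : ι =>
    isCompact_Icc.exists_bound_of_continuousOn (hA (Pi.single i 1))
  refine ⟨∑ i, (C i).toNNReal, fun t ht x => ?_⟩
  have hx : A t x = ∑ i, x i • A t (Pi.single i 1) := by
    conv_lhs => rw [pi_eq_sum_univ' x]
    simp only [map_sum, map_smul]
  rw [hx, NNReal.coe_sum, Finset.sum_mul]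
  refine (norm_sum_le _ _).trans (Finset.sum_le_sum fun i _ => ?_)
  rw [norm_smul, mul_comm]
  exact mul_le_mul ((hC i t ht).trans (Real.le_coe_toNNReal _)) (norm_le_pi_norm x i)
    (norm_nonneg _) (NNReal.coe_nonneg _)

/-- Solutions on `[a, b]` of the linear system `y' = A y + F`. -/
def SolvesLinearODE {ι : Type*} [Fintype ι] (a b : ℝ) (A : ℝ → (ι → ℝ) →ₗ[ℝ] (ι → ℝ))
    (F y : ℝ → ι → ℝ) : Prop :=
  ∀ t ∈ Icc a b, HasDerivWithinAt y (A t (y t) + F t) (Icc a b) t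

/-- Global existence for linear systems with continuous coefficients. -/
theorem exists_solvesLinearODE {ι : Type*} [Fintype ι] [DecidableEq ι] {a b : ℝ} (hab : a ≤ b)
    {A : ℝ → (ι → ℝ) →ₗ[ℝ] (ι → ℝ)} (hA : ∀ x, ContinuousOn (fun t => A t x) (Icc a b))
    {F : ℝ → ι → ℝ} (hF : ContinuousOn F (Icc a b)) (y₀ : ι → ℝ) :
    ∃ y, y a = y₀ ∧ SolvesLinearODE a b A F y := by
  obtain ⟨K, hK⟩ := exists_bound_linearMap_family hA
  obtain ⟨M₀, hM₀⟩ := isCompact_Icc.exists_bound_of_continuousOn hF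
  obtain ⟨M, hM⟩ : ∃ M : NNReal, ∀ t ∈ Icc a b, ‖F t‖ ≤ M :=
    ⟨M₀.toNNReal, fun t ht => (hM₀ t ht).trans (Real.le_coe_toNNReal _)⟩
  -- `R` is the a priori Grönwall bound for solutions. The field truncated at `R` is globally
  -- bounded and Lipschitz, so one Picard-Lindelöf step covers all of `[a, b]`.
  set R : ℝ := gronwallBound ‖y₀‖ K M (b - a)
  have hmono := gronwallBound_mono (norm_nonneg y₀) M.2 K.2
  have hR : 0 ≤ R := by
    have h := hmono (show (0 : ℝ) ≤ b - a by linarith)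
    rw [gronwallBound_x0] at h
    exact (norm_nonneg _).trans h
  set f : ℝ → (ι → ℝ) → (ι → ℝ) := fun t x => A t (clampCube R x) + F t with hf
  have hPL : IsPicardLindelof f (⟨a, le_rfl, hab⟩ : Icc a b) y₀
      ((K * R.toNNReal + M) * (b - a).toNNReal) 0 (K * R.toNNReal + M) K := by
    refine ⟨fun t ht => ?_, fun x _ => (hA _).add hF, fun t ht x _ => ?_, ?_⟩
    · refine (LipschitzWith.of_dist_le_mul fun x y => ?_).lipschitzOnWith
      simp only [hf, dist_add_right]
      rw [dist_eq_norm, ← map_sub]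
      refine (hK t ht _).trans (mul_le_mul_of_nonneg_left ?_ K.2)
      rw [← dist_eq_norm]
      simpa using (lipschitzWith_clampCube R).dist_le_mul x y
    · push_cast
      rw [Real.coe_toNNReal _ hR]
      exact (norm_add_le _ _).trans (add_le_add ((hK t ht _).trans
        (mul_le_mul_of_nonneg_left (norm_clampCube_le hR x) K.2)) (hM t ht))
    · have : 0 ≤ b - a := by linarith
      simp [this]
  obtain ⟨y, hya, hy⟩ := hPL.exists_eq_forall_mem_Icc_hasDerivWithinAt₀
  have hy' : ∀ t ∈ Icc a b, HasDerivWithinAt y (f t (y t)) (Icc a b) t := hy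
  -- Truncation does not increase norms, so the Grönwall bound also holds for the truncated
  -- solution; hence the truncation is never active.
  have hbound : ∀ t ∈ Icc a b, ‖y t‖ ≤ R := by
    intro t ht
    refine (norm_le_gronwallBound_of_norm_deriv_right_le (f' := fun t => f t (y t)) (K := K)
      (ε := M) (δ := ‖y₀‖) (fun s hs => (hy' s hs).continuousWithinAt) (fun s hs => ?_)
      (le_of_eq (congrArg norm hya)) (fun s hs => ?_) t ht).trans (hmono (by linarith [ht.2]))
    · exact ((hy' s ⟨hs.1, hs.2.le⟩).mono (Icc_subset_Icc_left hs.1)).mono_of_mem_nhdsWithin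
        (Icc_mem_nhdsGE hs.2)
    · have hs' : s ∈ Icc a b := ⟨hs.1, hs.2.le⟩
      exact (norm_add_le _ _).trans (add_le_add ((hK s hs' _).trans
        (mul_le_mul_of_nonneg_left (norm_clampCube_le_norm hR _) K.2)) (hM s hs'))
  refine ⟨y, hya, fun t ht => ?_⟩
  have h := hy' t ht
  simp only [hf, clampCube_eq_self (hbound t ht)] at h
  exact h

/-- Fredholm alternative for two-point boundary value problems of linear systems: uniqueness for the
homogeneous problem implies solvability of the inhomogeneous one. -/
theorem exists_solvesLinearODE_boundary {ι : Type*} [Fintype ι] [DecidableEq ι] {a b : ℝ}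
    (hab : a ≤ b) {A : ℝ → (ι → ℝ) →ₗ[ℝ] (ι → ℝ)}
    (hA : ∀ x, ContinuousOn (fun t => A t x) (Icc a b))
    {F : ℝ → ι → ℝ} (hF : ContinuousOn F (Icc a b))
    (B : (ι → ℝ) × (ι → ℝ) →ₗ[ℝ] (ι → ℝ))
    (hB : ∀ y, SolvesLinearODE a b A 0 y → B (y a, y b) = 0 → y a = 0) :
    ∃ y, SolvesLinearODE a b A F y ∧ B (y a, y b) = 0 := by
  choose Y hYa hY using fun i : ι =>
    exists_solvesLinearODE hab hA (F := 0) continuousOn_const (Pi.single i 1)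
  obtain ⟨y, -, hy⟩ := exists_solvesLinearODE hab hA hF 0
  let ev : (ι → ℝ) →ₗ[ℝ] (ι → ℝ) × (ι → ℝ) :=
    Fintype.linearCombination ℝ fun i => (Y i a, Y i b)
  have hev : ∀ c, ev c = ((∑ i, c i • Y i) a, (∑ i, c i • Y i) b) := by
    intro c
    simp only [ev, Fintype.linearCombination_apply, Finset.sum_apply, Pi.smul_apply]
    ext <;> simp [Prod.fst_sum, Prod.snd_sum]
  have hsum : ∀ c : ι → ℝ, ∀ t, (∑ i, c i • Y i) t = ∑ i, c i • Y i t := by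
    intro c t
    simp
  have hsol : ∀ c : ι → ℝ, SolvesLinearODE a b A 0 (∑ i, c i • Y i) := by
    intro c t ht
    rw [hsum]
    have h := HasDerivWithinAt.sum (u := Finset.univ)
      fun i _ => (hY i t ht).const_smul (c i)
    simpa [map_sum] using h
  have hval : ∀ c : ι → ℝ, (∑ i, c i • Y i) a = c := by
    intro c
    rw [hsum]
    simp only [hYa]
    exact (pi_eq_sum_univ' c).symm
  -- The map from initial values of homogeneous solutions to boundary data is a square matrix:
  -- injective by uniqueness, hence surjective. It can therefore cancel the boundary data of any
  -- particular solution.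
  have hinj : Function.Injective (B ∘ₗ ev) := by
    rw [← LinearMap.ker_eq_bot, LinearMap.ker_eq_bot']
    intro c hc
    rw [LinearMap.comp_apply, hev] at hc
    rw [← hval c]
    exact hB _ (hsol c) hc
  obtain ⟨c, hc⟩ := LinearMap.injective_iff_surjective.1 hinj (-B (y a, y b))
  refine ⟨(∑ i, c i • Y i) + y, fun t ht => ?_, ?_⟩
  · have h := (hsol c t ht).add (hy t ht)
    simp only [Pi.zero_apply, add_zero] at h
    rw [Pi.add_apply, map_add, add_assoc]
    exact h
  · rw [Pi.add_apply, Pi.add_apply, ← Prod.mk_add_mk, map_add, ← hev]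
    rw [LinearMap.comp_apply] at hc
    rw [hc, neg_add_cancel]

/-! ### Sturm-Liouville equations in first-order form -/

/-- First-order form of `(p w')' + q w = f` on `I`: the pair `(w, z)` satisfies `p w' = z` and
`z' = f - q w`. -/
def IsSLPair (p q f : ℝ → ℝ) (I : Set ℝ) (w z : ℝ → ℝ) : Prop :=
  ∀ r ∈ I, HasDerivWithinAt w (z r / p r) I r ∧ HasDerivWithinAt z (f r - q r * w r) I r

/-- The separated boundary condition of angle `θ` on the value `x` and the quasi-derivative `y`. -/
def EndCondition (θ x y : ℝ) : Prop := -Real.cos θ * x + Real.sin θ * y = 0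

namespace EndCondition

/-- Both vectors are orthogonal to the nonzero vector `(-cos θ, sin θ)` in the plane, hence
parallel. -/
theorem wronskian_eq_zero {θ x y x' y' : ℝ} (h : EndCondition θ x y) (h' : EndCondition θ x' y') :
    x * y' - y * x' = 0 := by
  unfold EndCondition at h h'
  have hs := Real.sin_sq_add_cos_sq θ
  linear_combination (-(x * y' - y * x')) * hs +
    (Real.cos θ * y' + Real.sin θ * x') * h * (-1) + (Real.cos θ * y + Real.sin θ * x) * h'

/-- Controls the boundary term `w z` of the energy identity. In the Dirichlet case `sin θ = 0` the
quotient is `0` by convention, which is the right constant because then `x = 0`. -/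
theorem abs_mul_le {θ x y : ℝ} (h : EndCondition θ x y) :
    |x * y| ≤ |Real.cos θ / Real.sin θ| * x ^ 2 := by
  unfold EndCondition at h
  by_cases hs : Real.sin θ = 0
  · have hc : Real.cos θ ≠ 0 := by
      intro hc
      have := Real.sin_sq_add_cos_sq θ
      simp [hs, hc] at this
    have hx : x = 0 := by simpa [hs, hc] using h
    simp [hx]
  · have hy : y = Real.cos θ / Real.sin θ * x := by
      field_simp
      linarith
    rw [hy, ← abs_of_nonneg (sq_nonneg x), ← abs_mul]
    exact le_of_eq (congrArg abs (by ring))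

end EndCondition

namespace IsSLPair

variable {p q f w z : ℝ → ℝ} {I : Set ℝ}

theorem mono (h : IsSLPair p q f I w z) {I' : Set ℝ} (hI : I' ⊆ I) : IsSLPair p q f I' w z :=
  fun r hr => ⟨(h r (hI hr)).1.mono hI, (h r (hI hr)).2.mono hI⟩

theorem continuousOn (h : IsSLPair p q f I w z) : ContinuousOn w I :=
  fun r hr => (h r hr).1.continuousWithinAt

theorem continuousOn_quasiDeriv (h : IsSLPair p q f I w z) : ContinuousOn z I :=
  fun r hr => (h r hr).2.continuousWithinAt

theorem congr (h : IsSLPair p q f I w z) {w' : ℝ → ℝ} (hw : EqOn w' w I) :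
    IsSLPair p q f I w' z := by
  intro r hr
  rw [hw hr]
  exact ⟨(h r hr).1.congr hw (hw hr), (h r hr).2⟩

theorem const_mul (h : IsSLPair p q 0 I w z) (k : ℝ) :
    IsSLPair p q 0 I (fun r => k * w r) (fun r => k * z r) := by
  intro r hr
  refine ⟨((h r hr).1.const_mul k).congr_deriv (by ring), ((h r hr).2.const_mul k).congr_deriv ?_⟩
  simp only [Pi.zero_apply]
  ring

theorem sub_const_mul (h : IsSLPair p q 0 I w z) {w' z' : ℝ → ℝ} (h' : IsSLPair p q 0 I w' z')
    (k : ℝ) : IsSLPair p q 0 I (fun r => w' r - k * w r) (fun r => z' r - k * z r) := by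
  intro r hr
  refine ⟨((h' r hr).1.sub ((h r hr).1.const_mul k)).congr_deriv (by ring),
    ((h' r hr).2.sub ((h r hr).2.const_mul k)).congr_deriv ?_⟩
  simp only [Pi.zero_apply]
  ring

variable {c d : ℝ}

theorem derivWithin_eq (h : IsSLPair p q f (Icc c d) w z) (hcd : c < d) {r : ℝ}
    (hr : r ∈ Icc c d) : derivWithin w (Icc c d) r = z r / p r :=
  (h r hr).1.derivWithin (uniqueDiffOn_Icc hcd r hr)

theorem slOp_eq (h : IsSLPair p q f (Icc c d) w z) (hcd : c < d)
    (hp : ∀ r ∈ Icc c d, p r ≠ 0) {r : ℝ} (hr : r ∈ Icc c d) :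
    slOp p q (Icc c d) w r = f r := by
  have hz : EqOn (fun s => p s * derivWithin w (Icc c d) s) z (Icc c d) := fun s hs => by
    simp only [h.derivWithin_eq hcd hs]
    field_simp [hp s hs]
  rw [slOp, derivWithin_congr hz (hz hr), (h r hr).2.derivWithin (uniqueDiffOn_Icc hcd r hr)]
  ring

/-- Bootstrapping: `z' = f - q w` is continuous, so `z` and then `w' = z / p` are `C¹`. -/
theorem contDiffOn_two (h : IsSLPair p q f (Icc c d) w z) (hcd : c < d)
    (hp : ∀ r ∈ Icc c d, p r ≠ 0) (hp1 : ContDiffOn ℝ 1 p (Icc c d))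
    (hq : ContinuousOn q (Icc c d)) (hf : ContinuousOn f (Icc c d)) :
    ContDiffOn ℝ 2 w (Icc c d) := by
  have hu := uniqueDiffOn_Icc hcd
  have hz : ContDiffOn ℝ 1 z (Icc c d) := by
    rw [show (1 : WithTop ℕ∞) = 0 + 1 from rfl, contDiffOn_succ_iff_derivWithin hu]
    refine ⟨fun r hr => (h r hr).2.differentiableWithinAt, by simp, contDiffOn_zero.2 ?_⟩
    exact (hf.sub (hq.mul h.continuousOn)).congr fun r hr => (h r hr).2.derivWithin (hu r hr)
  rw [show (2 : WithTop ℕ∞) = 1 + 1 by norm_num, contDiffOn_succ_iff_derivWithin hu]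
  exact ⟨fun r hr => (h r hr).1.differentiableWithinAt, by simp,
    (hz.div hp1 hp).congr fun r hr => h.derivWithin_eq hcd hr⟩

theorem slBoundary (h : IsSLPair p q f (Icc c d) w z) (hcd : c < d)
    (hp : ∀ r ∈ Icc c d, p r ≠ 0) {θ : ℝ × ℝ} (hc : EndCondition θ.1 (w c) (z c))
    (hd : EndCondition θ.2 (w d) (z d)) : SLBoundary p c d θ w := by
  have hcm : c ∈ Icc c d := ⟨le_rfl, hcd.le⟩
  have hdm : d ∈ Icc c d := ⟨hcd.le, le_rfl⟩
  unfold EndCondition at hc hd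
  rw [SLBoundary, h.derivWithin_eq hcd hcm, h.derivWithin_eq hcd hdm]
  constructor
  · rw [← hc]
    field_simp [hp c hcm]
  · rw [← hd]
    field_simp [hp d hdm]

/-- Lagrange's identity for a homogeneous and an inhomogeneous solution. -/
theorem hasDerivWithinAt_wronskian {u zu : ℝ → ℝ} (hu : IsSLPair p q 0 I u zu)
    (h : IsSLPair p q f I w z) {r : ℝ} (hr : r ∈ I) :
    HasDerivWithinAt (fun s => u s * z s - zu s * w s) (u r * f r) I r := by
  refine (((hu r hr).1.mul (h r hr).2).sub ((hu r hr).2.mul (h r hr).1)).congr_deriv ?_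
  simp only [Pi.zero_apply]
  ring

/-- Integrated Lagrange identity. With `f = 0` it says that the Wronskian is constant; with general
`f` it evaluates the two halves of the Green's integral. -/
theorem integral_mul_eq_wronskian {u zu : ℝ → ℝ} (hcd : c ≤ d)
    (hu : IsSLPair p q 0 (Icc c d) u zu) (h : IsSLPair p q f (Icc c d) w z)
    (hf : ContinuousOn f (Icc c d)) :
    ∫ t in c..d, u t * f t = (u d * z d - zu d * w d) - (u c * z c - zu c * w c) := by
  have hD := fun r (hr : r ∈ Icc c d) => hu.hasDerivWithinAt_wronskian h hr
  exact intervalIntegral.integral_eq_sub_of_hasDerivAt_of_le hcd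
    (fun r hr => (hD r hr).continuousWithinAt)
    (fun r hr => (hD r (Ioo_subset_Icc_self hr)).hasDerivAt (Icc_mem_nhds hr.1 hr.2))
    ((hu.continuousOn.mul hf).intervalIntegrable_of_Icc hcd)

/-! ### Energy estimates -/

/-- Energy estimate: with `q ≤ -μ`, the form `-∫ w ((p w')' + q w)` is bounded below by
`(μ - C) ∫ w²`, where `C` depends only on a lower bound of `p`, the angles and the interval. -/
theorem energy_estimate (h : IsSLPair p q f (Icc c d) w z) (hcd : c < d) {p₀ μ k : ℝ}
    (hp₀ : 0 < p₀) (hp : ∀ r ∈ Icc c d, p₀ ≤ p r) (hq : ∀ r ∈ Icc c d, q r ≤ -μ)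
    (hpc : ContinuousOn p (Icc c d)) (hqc : ContinuousOn q (Icc c d))
    (hf : ContinuousOn f (Icc c d)) (hkc : |w c * z c| ≤ k * w c ^ 2)
    (hkd : |w d * z d| ≤ k * w d ^ 2) :
    (μ - (k * (2 / (d - c)) + k ^ 2 / p₀)) * ∫ r in c..d, w r ^ 2 ≤
      -∫ r in c..d, f r * w r := by
  have hdc : 0 < d - c := sub_pos.2 hcd
  have hpne : ∀ r ∈ Icc c d, p r ≠ 0 := fun r hr => (hp₀.trans_le (hp r hr)).ne'
  set m := μ - (k * (2 / (d - c)) + k ^ 2 / p₀) with hm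
  -- The affine function from `-1` at `c` to `1` at `d`. Subtracting `k φ w²` from `w z` makes the
  -- boundary contribution nonpositive at both ends, which replaces a trace inequality.
  set φ : ℝ → ℝ := fun r => (2 * r - c - d) / (d - c) with hφ
  set E : ℝ → ℝ := fun r => w r * z r - k * (φ r * w r ^ 2) with hE
  set E' : ℝ → ℝ := fun r => z r / p r * z r + w r * (f r - q r * w r) -
    k * (2 / (d - c) * w r ^ 2 + φ r * (2 * w r * (z r / p r))) with hE'
  have hφd : ∀ r, HasDerivAt φ (2 / (d - c)) r := fun r =>
    (((((hasDerivAt_id r).const_mul 2).sub_const c).sub_const d).div_const (d - c)).congr_deriv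
      (by simp)
  have hφc : Continuous φ := by
    rw [hφ]
    fun_prop
  have hw := h.continuousOn
  have hz := h.continuousOn_quasiDeriv
  have hD : ∀ r ∈ Icc c d, HasDerivWithinAt E (E' r) (Icc c d) r := fun r hr =>
    (((h r hr).1.mul (h r hr).2).sub
      (((hφd r).hasDerivWithinAt.mul ((h r hr).1.pow 2)).const_mul k)).congr_deriv (by
        simp only [hE', Pi.pow_apply]
        push_cast
        ring)
  have hE'c : ContinuousOn E' (Icc c d) := by
    have hzp := hz.div hpc hpne
    exact ((hzp.mul hz).add (hw.mul (hf.sub (hqc.mul hw)))).sub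
      (continuousOn_const.mul ((continuousOn_const.mul (hw.pow 2)).add
        (hφc.continuousOn.mul ((continuousOn_const.mul hw).mul hzp))))
  have hint : ∫ r in c..d, E' r = E d - E c :=
    intervalIntegral.integral_eq_sub_of_hasDerivAt_of_le hcd.le
      (fun r hr => (hD r hr).continuousWithinAt)
      (fun r hr => (hD r (Ioo_subset_Icc_self hr)).hasDerivAt (Icc_mem_nhds hr.1 hr.2))
      (hE'c.intervalIntegrable_of_Icc hcd.le)
  have hEle : E d - E c ≤ 0 := by
    have h1 : φ d = 1 := by
      simp only [hφ]
      field_simp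
      ring
    have h2 : φ c = -1 := by
      simp only [hφ]
      field_simp
      ring
    simp only [hE, h1, h2]
    linarith [(abs_le.1 hkc).1, (abs_le.1 hkd).2]
  have hpt : ∀ r ∈ Icc c d, f r * w r + m * w r ^ 2 ≤ E' r := by
    intro r hr
    have hpr := hp₀.trans_le (hp r hr)
    have hφ1 : φ r ^ 2 ≤ 1 := by
      rw [sq_le_one_iff_abs_le_one, abs_le]
      simp only [hφ]
      rw [le_div_iff₀ hdc, div_le_iff₀ hdc]
      constructor <;> linarith [hr.1, hr.2]
    have hsq : 0 ≤ (z r - k * φ r * w r) ^ 2 / p r := by positivity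
    have h3 : k ^ 2 * φ r ^ 2 * w r ^ 2 / p r ≤ k ^ 2 / p₀ * w r ^ 2 := by
      rw [div_mul_eq_mul_div]
      refine div_le_div₀ (by positivity) ?_ hp₀ (hp r hr)
      have := mul_le_mul_of_nonneg_left hφ1 (show 0 ≤ k ^ 2 * w r ^ 2 by positivity)
      linarith
    have h4 : (-q r - μ) * w r ^ 2 ≥ 0 := mul_nonneg (by linarith [hq r hr]) (sq_nonneg _)
    -- Completing the square in `z` absorbs the cross term `2 k φ w z / p`; the price is `k² φ² w² /
    -- p ≤ (k² / p₀) w²`.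
    have h5 : E' r = (z r - k * φ r * w r) ^ 2 / p r - k ^ 2 * φ r ^ 2 * w r ^ 2 / p r +
        f r * w r - q r * w r ^ 2 - k * (2 / (d - c)) * w r ^ 2 := by
      simp only [hE']
      field_simp
      ring
    rw [h5, hm]
    nlinarith
  have hfw : IntervalIntegrable (fun r => f r * w r) MeasureTheory.volume c d :=
    (hf.mul hw).intervalIntegrable_of_Icc hcd.le
  have hww : IntervalIntegrable (fun r => m * w r ^ 2) MeasureTheory.volume c d :=
    (continuousOn_const.mul (hw.pow 2)).intervalIntegrable_of_Icc hcd.le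
  have hle := intervalIntegral.integral_mono_on hcd.le (hfw.add hww)
    (hE'c.intervalIntegrable_of_Icc hcd.le) hpt
  rw [hint, intervalIntegral.integral_add hfw hww, intervalIntegral.integral_const_mul] at hle
  linarith

/-- Energy estimate under separated boundary conditions. -/
theorem exists_energy_constant {p : ℝ → ℝ} (hcd : c < d) (hpc : ContinuousOn p (Icc c d))
    (hp : ∀ r ∈ Icc c d, 0 < p r) (θ : ℝ × ℝ) :
    ∃ C : ℝ, ∀ (μ : ℝ) (q f w z : ℝ → ℝ), IsSLPair p q f (Icc c d) w z →
      (∀ r ∈ Icc c d, q r ≤ -μ) → ContinuousOn q (Icc c d) → ContinuousOn f (Icc c d) →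
      EndCondition θ.1 (w c) (z c) → EndCondition θ.2 (w d) (z d) →
      (μ - C) * ∫ r in c..d, w r ^ 2 ≤ -∫ r in c..d, f r * w r := by
  obtain ⟨r₀, hr₀, hmin⟩ := isCompact_Icc.exists_isMinOn (nonempty_Icc.2 hcd.le) hpc
  set k := max |Real.cos θ.1 / Real.sin θ.1| |Real.cos θ.2 / Real.sin θ.2|
  refine ⟨k * (2 / (d - c)) + k ^ 2 / p r₀, fun μ q f w z h hq hqc hf hc hd => ?_⟩
  exact h.energy_estimate hcd (hp r₀ hr₀) (fun r hr => hmin hr) hq hpc hqc hf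
    (hc.abs_mul_le.trans (mul_le_mul_of_nonneg_right (le_max_left _ _) (sq_nonneg _)))
    (hd.abs_mul_le.trans (mul_le_mul_of_nonneg_right (le_max_right _ _) (sq_nonneg _)))

/-- A solution whose square integral vanishes is identically zero. -/
theorem eq_zero_of_integral_sq_nonpos (h : IsSLPair p q f (Icc c d) w z) (hcd : c < d)
    (hp : ∀ r ∈ Icc c d, p r ≠ 0) (h0 : ∫ r in c..d, w r ^ 2 ≤ 0) :
    ∀ r ∈ Icc c d, w r = 0 ∧ z r = 0 := by
  have hw : ∀ r ∈ Icc c d, w r = 0 := by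
    intro r hr
    by_contra hne
    refine absurd (intervalIntegral.integral_pos hcd (h.continuousOn.pow 2)
      (fun s _ => sq_nonneg _) ⟨r, hr, sq_pos_iff.2 hne⟩) (not_lt.2 h0)
  refine fun r hr => ⟨hw r hr, ?_⟩
  have h1 : derivWithin w (Icc c d) r = 0 := by
    rw [derivWithin_congr (f := fun _ => (0 : ℝ)) (fun s hs => hw s hs) (hw r hr)]
    simp
  rw [h.derivWithin_eq hcd hr, div_eq_zero_iff] at h1
  exact h1.resolve_right (hp r hr)

end IsSLPair

/-- If `m ∫ w² ≤ -∫ f w` with `m > 0`, then `m² ∫ w² ≤ ∫ f²`. -/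
theorem sq_mul_integral_sq_le {c d m : ℝ} (hcd : c ≤ d) (hm : 0 < m) {f w : ℝ → ℝ}
    (hf : ContinuousOn f (Icc c d)) (hw : ContinuousOn w (Icc c d))
    (h : m * ∫ r in c..d, w r ^ 2 ≤ -∫ r in c..d, f r * w r) :
    m ^ 2 * ∫ r in c..d, w r ^ 2 ≤ ∫ r in c..d, f r ^ 2 := by
  have hi1 : IntervalIntegrable (fun r => m ^ 2 * w r ^ 2) MeasureTheory.volume c d :=
    (continuousOn_const.mul (hw.pow 2)).intervalIntegrable_of_Icc hcd
  have hi2 : IntervalIntegrable (fun r => 2 * m * (f r * w r)) MeasureTheory.volume c d :=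
    (continuousOn_const.mul (hf.mul hw)).intervalIntegrable_of_Icc hcd
  have hi3 : IntervalIntegrable (fun r => f r ^ 2) MeasureTheory.volume c d :=
    (hf.pow 2).intervalIntegrable_of_Icc hcd
  -- The integrand is `(m w + f)²`; the hypothesis bounds its cross term.
  have h0 : 0 ≤ ∫ r in c..d, (m ^ 2 * w r ^ 2 + 2 * m * (f r * w r) + f r ^ 2) :=
    intervalIntegral.integral_nonneg hcd fun r _ => by nlinarith [sq_nonneg (m * w r + f r)]
  rw [intervalIntegral.integral_add (hi1.add hi2) hi3, intervalIntegral.integral_add hi1 hi2,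
    intervalIntegral.integral_const_mul, intervalIntegral.integral_const_mul] at h0
  nlinarith

/-! ### The Green's function -/

/-- The linear map `(w, z) ↦ (z / p, -q w)` of the first-order system of `(p w')' + q w`. -/
noncomputable def slSystem (p q : ℝ → ℝ) (t : ℝ) : (Fin 2 → ℝ) →ₗ[ℝ] (Fin 2 → ℝ) where
  toFun x := ![x 1 / p t, -(q t * x 0)]
  map_add' x y := by
    ext i
    fin_cases i <;> simp <;> ring
  map_smul' k x := by
    ext i
    fin_cases i <;> simp <;> ring

/-- Initial value problem at the left end point for `(p w')' + q w = 0`. -/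
theorem exists_isSLPair {p q : ℝ → ℝ} {a b : ℝ} (hab : a ≤ b) (hp : ContinuousOn p (Icc a b))
    (hp0 : ∀ r ∈ Icc a b, p r ≠ 0) (hq : ContinuousOn q (Icc a b)) (x y : ℝ) :
    ∃ w z, IsSLPair p q 0 (Icc a b) w z ∧ w a = x ∧ z a = y := by
  obtain ⟨Y, hYa, hY⟩ := exists_solvesLinearODE hab (A := slSystem p q) (F := 0) (fun v => by
    rw [continuousOn_pi]
    intro i
    fin_cases i
    · exact continuousOn_const.div hp hp0
    · exact (hq.mul continuousOn_const).neg) continuousOn_const ![x, y]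
  refine ⟨fun t => Y t 0, fun t => Y t 1, fun t ht => ?_, by simp [hYa], by simp [hYa]⟩
  have h := hasDerivWithinAt_pi.1 (hY t ht)
  refine ⟨(h 0).congr_deriv ?_, (h 1).congr_deriv ?_⟩ <;> simp [slSystem]

/-- A fundamental system adapted to separated boundary conditions: `u` satisfies the left one, `v`
the right one, and their Wronskian is `1`. -/
structure IsAdaptedPair (p q : ℝ → ℝ) (a b : ℝ) (θ : ℝ × ℝ) (u zu v zv : ℝ → ℝ) : Prop where
  left : IsSLPair p q 0 (Icc a b) u zu
  right : IsSLPair p q 0 (Icc a b) v zv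
  left_end : EndCondition θ.1 (u a) (zu a)
  right_end : EndCondition θ.2 (v b) (zv b)
  wronskian : ∀ r ∈ Icc a b, u r * zv r - zu r * v r = 1

/-- The Green's function built from `u` and `v`. -/
def greenKernel (u v : ℝ → ℝ) (r t : ℝ) : ℝ := u (min r t) * v (max r t)

/-- Start from two solutions with orthonormal data at `a`, so that their Wronskian is `1`.
Subtracting a multiple of `u` from `v` keeps the Wronskian and can enforce the right condition,
because `u` violates it: otherwise `u` would be a nontrivial solution of the boundary value problem.
-/
theorem exists_isAdaptedPair {p q : ℝ → ℝ} {a b : ℝ} (hab : a < b) (hp : ContinuousOn p (Icc a b))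
    (hp0 : ∀ r ∈ Icc a b, p r ≠ 0) (hq : ContinuousOn q (Icc a b)) (θ : ℝ × ℝ)
    (huniq : ∀ w z, IsSLPair p q 0 (Icc a b) w z → EndCondition θ.1 (w a) (z a) →
      EndCondition θ.2 (w b) (z b) → w a = 0 ∧ z a = 0) :
    ∃ u zu v zv, IsAdaptedPair p q a b θ u zu v zv := by
  obtain ⟨u, zu, hu, hua, hzua⟩ :=
    exists_isSLPair hab.le hp hp0 hq (Real.sin θ.1) (Real.cos θ.1)
  obtain ⟨v, zv, hv, hva, hzva⟩ :=
    exists_isSLPair hab.le hp hp0 hq (-Real.cos θ.1) (Real.sin θ.1)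
  have hsc := Real.sin_sq_add_cos_sq θ.1
  have hend : EndCondition θ.1 (u a) (zu a) := by
    rw [EndCondition, hua, hzua]
    ring
  have hβ : -Real.cos θ.2 * u b + Real.sin θ.2 * zu b ≠ 0 := by
    intro h0
    obtain ⟨h1, h2⟩ := huniq u zu hu hend h0
    rw [← hua, ← hzua, h1, h2] at hsc
    norm_num at hsc
  set k := (-Real.cos θ.2 * v b + Real.sin θ.2 * zv b) /
    (-Real.cos θ.2 * u b + Real.sin θ.2 * zu b) with hk
  refine ⟨u, zu, _, _, hu, hu.sub_const_mul hv k, hend, ?_, fun r hr => ?_⟩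
  · have : k * (-Real.cos θ.2 * u b + Real.sin θ.2 * zu b) =
        -Real.cos θ.2 * v b + Real.sin θ.2 * zv b := div_mul_cancel₀ _ hβ
    unfold EndCondition
    linarith
  · have hsub : Icc a r ⊆ Icc a b := Icc_subset_Icc_right hr.2
    have h := (hu.mono hsub).integral_mul_eq_wronskian hr.1 (hv.mono hsub) continuousOn_const
    simp only [Pi.zero_apply, mul_zero, intervalIntegral.integral_zero, hua, hzua, hva, hzva] at h
    linarith

namespace IsAdaptedPair

variable {p q : ℝ → ℝ} {a b : ℝ} {θ : ℝ × ℝ} {u zu v zv : ℝ → ℝ}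

theorem isSLPair_greenKernel_left (h : IsAdaptedPair p q a b θ u zu v zv) {t : ℝ}
    (ht : t ∈ Icc a b) :
    IsSLPair p q 0 (Icc a t) (fun r => greenKernel u v r t) (fun r => v t * zu r) :=
  ((h.left.mono (Icc_subset_Icc_right ht.2)).const_mul (v t)).congr fun r hr => by
    simp only [greenKernel, min_eq_left hr.2, max_eq_right hr.2, mul_comm]

theorem isSLPair_greenKernel_right (h : IsAdaptedPair p q a b θ u zu v zv) {t : ℝ}
    (ht : t ∈ Icc a b) :
    IsSLPair p q 0 (Icc t b) (fun r => greenKernel u v r t) (fun r => u t * zv r) :=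
  ((h.right.mono (Icc_subset_Icc_left ht.1)).const_mul (u t)).congr fun r hr => by
    simp only [greenKernel, min_eq_right hr.1, max_eq_left hr.1]

theorem isGreenFunction (h : IsAdaptedPair p q a b θ u zu v zv)
    (hp0 : ∀ r ∈ Icc a b, p r ≠ 0) (hp1 : ContDiffOn ℝ 1 p (Icc a b))
    (hq : ContinuousOn q (Icc a b)) : IsGreenFunction p q a b θ (greenKernel u v) := by
  have hl : ∀ t ∈ Ioo a b, Icc a t ⊆ Icc a b := fun t ht => Icc_subset_Icc_right ht.2.le
  have hr : ∀ t ∈ Ioo a b, Icc t b ⊆ Icc a b := fun t ht => Icc_subset_Icc_left ht.1.le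
  have hL := fun t (ht : t ∈ Ioo a b) => h.isSLPair_greenKernel_left (Ioo_subset_Icc_self ht)
  have hR := fun t (ht : t ∈ Ioo a b) => h.isSLPair_greenKernel_right (Ioo_subset_Icc_self ht)
  refine ⟨?_, fun t ht => ?_, fun t ht => ?_, fun t ht => ?_, fun t ht r hrt => ?_,
    fun t ht r hrt => ?_, fun t ht => ?_⟩
  · refine ContinuousOn.mul (h.left.continuousOn.comp (by fun_prop) ?_)
      (h.right.continuousOn.comp (by fun_prop) ?_)
    · exact fun x hx => ⟨le_min hx.1.1 hx.2.1, (min_le_left _ _).trans hx.1.2⟩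
    · exact fun x hx => ⟨hx.1.1.trans (le_max_left _ _), max_le hx.1.2 hx.2.2⟩
  · have ha : a ∈ Icc a b := ⟨le_rfl, (ht.1.trans ht.2).le⟩
    have hb : b ∈ Icc a b := ⟨(ht.1.trans ht.2).le, le_rfl⟩
    -- The boundary conditions use derivatives within `[a, b]`; since `a < t`, this interval and
    -- `[a, t]` agree near `a`. The same works at `b`.
    have hda : derivWithin (fun r => greenKernel u v r t) (Icc a b) a = v t * zu a / p a := by
      rw [← (hL t ht).derivWithin_eq ht.1 ⟨le_rfl, ht.1.le⟩]
      exact derivWithin_congr_set (Filter.eventuallyEq_set.2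
        (mem_of_superset (Iio_mem_nhds ht.1) fun x hx => ⟨fun hx' => ⟨hx'.1, le_of_lt hx⟩,
          fun hx' => ⟨hx'.1, hx'.2.trans ht.2.le⟩⟩))
    have hdb : derivWithin (fun r => greenKernel u v r t) (Icc a b) b = u t * zv b / p b := by
      rw [← (hR t ht).derivWithin_eq ht.2 ⟨ht.2.le, le_rfl⟩]
      exact derivWithin_congr_set (Filter.eventuallyEq_set.2
        (mem_of_superset (Ioi_mem_nhds ht.2) fun x hx => ⟨fun hx' => ⟨le_of_lt hx, hx'.2⟩,
          fun hx' => ⟨ht.1.le.trans hx'.1, hx'.2⟩⟩))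
    have h1 := h.left_end
    have h2 := h.right_end
    unfold EndCondition at h1 h2
    rw [SLBoundary, hda, hdb]
    simp only [greenKernel, min_eq_left ht.1.le, max_eq_right ht.1.le, min_eq_right ht.2.le,
      max_eq_left ht.2.le]
    constructor
    · field_simp [hp0 a ha]
      linear_combination v t * h1
    · field_simp [hp0 b hb]
      linear_combination u t * h2
  · exact (hL t ht).contDiffOn_two ht.1 (fun r hrt => hp0 r (hl t ht hrt)) (hp1.mono (hl t ht))
      (hq.mono (hl t ht)) continuousOn_const
  · exact (hR t ht).contDiffOn_two ht.2 (fun r hrt => hp0 r (hr t ht hrt)) (hp1.mono (hr t ht))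
      (hq.mono (hr t ht)) continuousOn_const
  · exact (hL t ht).slOp_eq ht.1 (fun r hrt => hp0 r (hl t ht hrt)) hrt
  · exact (hR t ht).slOp_eq ht.2 (fun r hrt => hp0 r (hr t ht hrt)) hrt
  · rw [(hL t ht).derivWithin_eq ht.1 ⟨ht.1.le, le_rfl⟩,
      (hR t ht).derivWithin_eq ht.2 ⟨le_rfl, ht.2.le⟩, ← sub_div,
      ← h.wronskian t (Ioo_subset_Icc_self ht)]
    ring

/-- Green's representation of the solution of an inhomogeneous boundary value problem. -/
theorem kernelOp_greenKernel_eq (h : IsAdaptedPair p q a b θ u zu v zv) {f w z : ℝ → ℝ}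
    (hw : IsSLPair p q f (Icc a b) w z) (hf : ContinuousOn f (Icc a b))
    (ha : EndCondition θ.1 (w a) (z a)) (hb : EndCondition θ.2 (w b) (z b)) {r : ℝ}
    (hr : r ∈ Icc a b) : kernelOp a b (greenKernel u v) f r = w r := by
  have hl : Icc a r ⊆ Icc a b := Icc_subset_Icc_right hr.2
  have hr' : Icc r b ⊆ Icc a b := Icc_subset_Icc_left hr.1
  have e1 : ∀ t ∈ Icc a r, greenKernel u v r t * f t = v r * (u t * f t) := fun t ht => by
    simp only [greenKernel, min_eq_right ht.2, max_eq_left ht.2]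
    ring
  have e2 : ∀ t ∈ Icc r b, greenKernel u v r t * f t = u r * (v t * f t) := fun t ht => by
    simp only [greenKernel, min_eq_left ht.1, max_eq_right ht.1]
    ring
  have c1 : ContinuousOn (fun t => v r * (u t * f t)) (Icc a r) :=
    continuousOn_const.mul ((h.left.continuousOn.mul hf).mono hl)
  have c2 : ContinuousOn (fun t => u r * (v t * f t)) (Icc r b) :=
    continuousOn_const.mul ((h.right.continuousOn.mul hf).mono hr')
  rw [kernelOp, ← intervalIntegral.integral_add_adjacent_intervals
      ((c1.congr e1).intervalIntegrable_of_Icc hr.1) ((c2.congr e2).intervalIntegrable_of_Icc hr.2),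
    intervalIntegral.integral_congr (g := fun t => v r * (u t * f t))
      (fun t ht => e1 t (by rwa [uIcc_of_le hr.1] at ht)),
    intervalIntegral.integral_congr (g := fun t => u r * (v t * f t))
      (fun t ht => e2 t (by rwa [uIcc_of_le hr.2] at ht)),
    intervalIntegral.integral_const_mul, intervalIntegral.integral_const_mul,
    (h.left.mono hl).integral_mul_eq_wronskian hr.1 (hw.mono hl) (hf.mono hl),
    (h.right.mono hr').integral_mul_eq_wronskian hr.2 (hw.mono hr') (hf.mono hr'),
    h.left_end.wronskian_eq_zero ha, h.right_end.wronskian_eq_zero hb]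
  -- What remains is `v (u z - zu w) - u (v z - zv w) = w (u zv - zu v)`; the Wronskians with `w` at
  -- `a` and `b` have vanished by the boundary conditions.
  linear_combination w r * h.wronskian r hr

end IsAdaptedPair

/-! ### The coupled boundary value problem -/

/-- Two Sturm-Liouville equations coupled through their right-hand sides,
`(p₁ Φ')' + q₁ Φ = k η + S` and `(p₂ η')' + q₂ η = h Φ`, under separated boundary conditions. -/
structure IsCoupledSolution (p₁ q₁ p₂ q₂ k h S : ℝ → ℝ) (a b : ℝ) (θ ϑ : ℝ × ℝ)
    (Φ Ψ η ξ : ℝ → ℝ) : Prop where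
  fst : IsSLPair p₁ q₁ (fun r => k r * η r + S r) (Icc a b) Φ Ψ
  snd : IsSLPair p₂ q₂ (fun r => h r * Φ r) (Icc a b) η ξ
  fst_left : EndCondition θ.1 (Φ a) (Ψ a)
  fst_right : EndCondition θ.2 (Φ b) (Ψ b)
  snd_left : EndCondition ϑ.1 (η a) (ξ a)
  snd_right : EndCondition ϑ.2 (η b) (ξ b)

/-- The matrix of the first-order system of the coupled equations. -/
noncomputable def coupledSystem (p₁ q₁ p₂ q₂ k h : ℝ → ℝ) (t : ℝ) :
    (Fin 4 → ℝ) →ₗ[ℝ] (Fin 4 → ℝ) where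
  toFun x := ![x 1 / p₁ t, k t * x 2 - q₁ t * x 0, x 3 / p₂ t, h t * x 0 - q₂ t * x 2]
  map_add' x y := by
    ext i
    fin_cases i <;> simp <;> ring
  map_smul' c x := by
    ext i
    fin_cases i <;> simp <;> ring

/-- The boundary form of the coupled equations. -/
noncomputable def coupledBoundary (θ ϑ : ℝ × ℝ) :
    (Fin 4 → ℝ) × (Fin 4 → ℝ) →ₗ[ℝ] (Fin 4 → ℝ) where
  toFun x := ![-Real.cos θ.1 * x.1 0 + Real.sin θ.1 * x.1 1,
    -Real.cos θ.2 * x.2 0 + Real.sin θ.2 * x.2 1,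
    -Real.cos ϑ.1 * x.1 2 + Real.sin ϑ.1 * x.1 3,
    -Real.cos ϑ.2 * x.2 2 + Real.sin ϑ.2 * x.2 3]
  map_add' x y := by
    ext i
    fin_cases i <;> simp <;> ring
  map_smul' c x := by
    ext i
    fin_cases i <;> simp <;> ring

theorem isCoupledSolution_of_solvesLinearODE {p₁ q₁ p₂ q₂ k h S : ℝ → ℝ} {a b : ℝ} {θ ϑ : ℝ × ℝ}
    {y : ℝ → Fin 4 → ℝ}
    (hy : SolvesLinearODE a b (coupledSystem p₁ q₁ p₂ q₂ k h) (fun t => ![0, S t, 0, 0]) y)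
    (hB : coupledBoundary θ ϑ (y a, y b) = 0) :
    IsCoupledSolution p₁ q₁ p₂ q₂ k h S a b θ ϑ (fun t => y t 0) (fun t => y t 1)
      (fun t => y t 2) (fun t => y t 3) := by
  have hD := fun t (ht : t ∈ Icc a b) => hasDerivWithinAt_pi.1 (hy t ht)
  refine ⟨fun t ht => ⟨(hD t ht 0).congr_deriv ?_, (hD t ht 1).congr_deriv ?_⟩,
    fun t ht => ⟨(hD t ht 2).congr_deriv ?_, (hD t ht 3).congr_deriv ?_⟩,
    congrFun hB 0, congrFun hB 1, congrFun hB 2, congrFun hB 3⟩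
  · simp [coupledSystem]
  · simp [coupledSystem]
    ring
  · simp [coupledSystem]
  · simp [coupledSystem]

/-- Uniqueness for the homogeneous coupled problem implies solvability for every source. -/
theorem exists_isCoupledSolution {p₁ q₁ p₂ q₂ k h S : ℝ → ℝ} {a b : ℝ} {θ ϑ : ℝ × ℝ} (hab : a ≤ b)
    (hp₁ : ContinuousOn p₁ (Icc a b)) (hp₁0 : ∀ r ∈ Icc a b, p₁ r ≠ 0)
    (hq₁ : ContinuousOn q₁ (Icc a b))
    (hp₂ : ContinuousOn p₂ (Icc a b)) (hp₂0 : ∀ r ∈ Icc a b, p₂ r ≠ 0)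
    (hq₂ : ContinuousOn q₂ (Icc a b)) (hk : ContinuousOn k (Icc a b))
    (hh : ContinuousOn h (Icc a b)) (hS : ContinuousOn S (Icc a b))
    (huniq : ∀ Φ Ψ η ξ, IsCoupledSolution p₁ q₁ p₂ q₂ k h 0 a b θ ϑ Φ Ψ η ξ →
      Φ a = 0 ∧ Ψ a = 0 ∧ η a = 0 ∧ ξ a = 0) :
    ∃ Φ Ψ η ξ, IsCoupledSolution p₁ q₁ p₂ q₂ k h S a b θ ϑ Φ Ψ η ξ := by
  obtain ⟨y, hy, hB⟩ := exists_solvesLinearODE_boundary hab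
    (A := coupledSystem p₁ q₁ p₂ q₂ k h) (F := fun t => ![0, S t, 0, 0]) (fun v => by
      rw [continuousOn_pi]
      intro i
      fin_cases i
      · exact continuousOn_const.div hp₁ hp₁0
      · exact (hk.mul continuousOn_const).sub (hq₁.mul continuousOn_const)
      · exact continuousOn_const.div hp₂ hp₂0
      · exact (hh.mul continuousOn_const).sub (hq₂.mul continuousOn_const)) (by
      rw [continuousOn_pi]
      intro i
      fin_cases i
      · exact continuousOn_const
      · exact hS
      · exact continuousOn_const
      · exact continuousOn_const) (coupledBoundary θ ϑ) (fun y hy hB => by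
      have h0 : (fun _ : ℝ => ![(0 : ℝ), (0 : ℝ → ℝ) 0, 0, 0]) = 0 := by
        funext t i
        fin_cases i <;> rfl
      obtain ⟨e0, e1, e2, e3⟩ := huniq _ _ _ _
        (isCoupledSolution_of_solvesLinearODE (S := 0) (h0 ▸ hy) hB)
      funext i
      fin_cases i
      exacts [e0, e1, e2, e3])
  exact ⟨_, _, _, _, isCoupledSolution_of_solvesLinearODE hy hB⟩

/-- Elimination of `η` from the energy inequalities of the coupled problem. -/
theorem coupled_energy_le {Φ η k h S : ℝ → ℝ} {a b m₁ m₂ K H : ℝ} (hab : a ≤ b) (hm₂ : 1 ≤ m₂)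
    (hΦ : ContinuousOn Φ (Icc a b)) (hη : ContinuousOn η (Icc a b)) (hk : ContinuousOn k (Icc a b))
    (hh : ContinuousOn h (Icc a b)) (hS : ContinuousOn S (Icc a b))
    (hkK : ∀ r ∈ Icc a b, |k r| ≤ K) (hhH : ∀ r ∈ Icc a b, |h r| ≤ H)
    (h₁ : m₁ * ∫ r in a..b, Φ r ^ 2 ≤ -∫ r in a..b, (k r * η r + S r) * Φ r)
    (h₂ : m₂ * ∫ r in a..b, η r ^ 2 ≤ -∫ r in a..b, (h r * Φ r) * η r) :
    ((m₁ - K * (1 + H ^ 2) / 2) * ∫ r in a..b, Φ r ^ 2 ≤ -∫ r in a..b, S r * Φ r) ∧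
      ∫ r in a..b, η r ^ 2 ≤ H ^ 2 * ∫ r in a..b, Φ r ^ 2 := by
  have hint : ∀ {f : ℝ → ℝ}, ContinuousOn f (Icc a b) →
      IntervalIntegrable f MeasureTheory.volume a b := fun hf => hf.intervalIntegrable_of_Icc hab
  have hη0 : 0 ≤ ∫ r in a..b, η r ^ 2 := intervalIntegral.integral_nonneg hab fun _ _ => sq_nonneg _
  have hη2 : ∫ r in a..b, η r ^ 2 ≤ H ^ 2 * ∫ r in a..b, Φ r ^ 2 := by
    have e := sq_mul_integral_sq_le (f := fun r => h r * Φ r) hab (zero_lt_one.trans_le hm₂)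
      (hh.mul hΦ) hη h₂
    have e2 : ∫ r in a..b, (h r * Φ r) ^ 2 ≤ ∫ r in a..b, H ^ 2 * Φ r ^ 2 := by
      refine intervalIntegral.integral_mono_on hab (hint ((hh.mul hΦ).pow 2))
        (hint (continuousOn_const.mul (hΦ.pow 2))) fun r hr => ?_
      rw [mul_pow]
      exact mul_le_mul_of_nonneg_right (sq_le_sq' (abs_le.1 (hhH r hr)).1 (abs_le.1 (hhH r hr)).2)
        (sq_nonneg _)
    rw [intervalIntegral.integral_const_mul] at e2
    have e3 : (1 : ℝ) ≤ m₂ ^ 2 := one_le_pow₀ hm₂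
    exact (le_mul_of_one_le_left hη0 e3).trans (e.trans e2)
  refine ⟨?_, hη2⟩
  have i1 : IntervalIntegrable (fun r => k r * η r * Φ r) MeasureTheory.volume a b :=
    hint ((hk.mul hη).mul hΦ)
  have i2 : IntervalIntegrable (fun r => S r * Φ r) MeasureTheory.volume a b := hint (hS.mul hΦ)
  have i3 : IntervalIntegrable (fun r => K / 2 * η r ^ 2) MeasureTheory.volume a b :=
    hint (continuousOn_const.mul (hη.pow 2))
  have i4 : IntervalIntegrable (fun r => K / 2 * Φ r ^ 2) MeasureTheory.volume a b :=
    hint (continuousOn_const.mul (hΦ.pow 2))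
  have hK : 0 ≤ K := (abs_nonneg _).trans (hkK a ⟨le_rfl, hab⟩)
  -- Young's inequality for the coupling term; `hη2` then turns the `η²` half into `Φ²`, for a total
  -- loss of `K (1 + H²) / 2`.
  have e1 : ∫ r in a..b, (K / 2 * η r ^ 2 + K / 2 * Φ r ^ 2) ≥
      ∫ r in a..b, -(k r * η r * Φ r) := by
    refine intervalIntegral.integral_mono_on hab i1.neg (i3.add i4) fun r hr => ?_
    have h3 : -(k r * η r * Φ r) ≤ K * (|η r| * |Φ r|) := by
      refine (neg_le_abs _).trans ?_
      rw [abs_mul, abs_mul, mul_assoc]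
      exact mul_le_mul_of_nonneg_right (hkK r hr) (by positivity)
    nlinarith [mul_nonneg hK (sq_nonneg (|η r| - |Φ r|)), sq_abs (η r), sq_abs (Φ r)]
  have e2 : ∫ r in a..b, (k r * η r + S r) * Φ r =
      (∫ r in a..b, k r * η r * Φ r) + ∫ r in a..b, S r * Φ r := by
    rw [← intervalIntegral.integral_add i1 i2]
    exact intervalIntegral.integral_congr fun r _ => by ring
  rw [intervalIntegral.integral_neg, intervalIntegral.integral_add i3 i4,
    intervalIntegral.integral_const_mul, intervalIntegral.integral_const_mul] at e1
  rw [e2] at h₁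
  have e4 := mul_le_mul_of_nonneg_left hη2 (show 0 ≤ K / 2 by linarith)
  linarith

/-! ### Application to the pulsation equations -/

namespace StellarModel

theorem contDiffOn_pJ (M : StellarModel) : ContDiffOn ℝ 1 M.pJ (Icc M.a M.b) :=
  (contDiffOn_id.pow 2).mul (M.ρ_smooth.of_le (by exact_mod_cast le_top))

theorem continuousOn_h (M : StellarModel) : ContinuousOn M.h (Icc M.a M.b) :=
  ((continuousOn_id.pow 2).mul M.ρ_smooth.continuousOn).div (M.c_smooth.continuousOn.pow 2)
    fun r hr => pow_ne_zero 2 (M.c_pos r hr).ne'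

theorem pJ_pos (M : StellarModel) : ∀ r ∈ Icc M.a M.b, 0 < M.pJ r := fun r hr =>
  mul_pos (pow_pos (M.a_pos.trans_le hr.1) 2) (M.ρ_pos r hr)

theorem pL_pos (M : StellarModel) : ∀ r ∈ Icc M.a M.b, 0 < pL r := fun _ hr =>
  pow_pos (M.a_pos.trans_le hr.1) 2

theorem qJ_eq (M : StellarModel) (ζ : ℝ) :
    M.qJ ζ = fun r => -(ζ ^ 2 * M.ρ r - M.σ ^ 2 * M.h r) := by
  funext r
  simp only [qJ, h]
  ring

theorem continuousOn_qJ (M : StellarModel) (ζ : ℝ) : ContinuousOn (M.qJ ζ) (Icc M.a M.b) := by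
  rw [qJ_eq]
  exact ((continuousOn_const.mul M.ρ_smooth.continuousOn).sub
    (continuousOn_const.mul M.continuousOn_h)).neg

theorem continuousOn_qL (M : StellarModel) (ζ : ℝ) : ContinuousOn (M.qL ζ) (Icc M.a M.b) :=
  (continuousOn_const.sub (continuousOn_const.mul M.continuousOn_h)).neg

/-- Energy estimates for the coupled pulsation equations, uniform in large `ζ`: the boundary value
problem for `J` is uniquely solvable, `Φ` is bounded by the source, and `η` by `Φ`. -/
theorem exists_energy_constant (M : StellarModel) (θ ϑ : ℝ × ℝ) :
    ∃ C H : ℝ, ∀ᶠ ζ : ℝ in atTop,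
      (∀ w z, IsSLPair M.pJ (M.qJ ζ) 0 (Icc M.a M.b) w z → EndCondition ϑ.1 (w M.a) (z M.a) →
        EndCondition ϑ.2 (w M.b) (z M.b) → w M.a = 0 ∧ z M.a = 0) ∧
      ∀ S Φ Ψ η ξ, ContinuousOn S (Icc M.a M.b) →
        IsCoupledSolution pL (M.qL ζ) M.pJ (M.qJ ζ) (fun r => M.σ ^ 2 * M.κ * M.h r) M.h S
          M.a M.b θ ϑ Φ Ψ η ξ →
        ((ζ ^ 2 - C) * ∫ r in M.a..M.b, Φ r ^ 2 ≤ -∫ r in M.a..M.b, S r * Φ r) ∧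
          ∫ r in M.a..M.b, η r ^ 2 ≤ H * ∫ r in M.a..M.b, Φ r ^ 2 := by
  have hab := M.a_lt_b
  obtain ⟨CL, hCL⟩ := IsSLPair.exists_energy_constant hab
    (p := pL) (continuousOn_id.pow 2) M.pL_pos θ
  obtain ⟨CJ, hCJ⟩ := IsSLPair.exists_energy_constant hab M.contDiffOn_pJ.continuousOn M.pJ_pos ϑ
  obtain ⟨H, hH⟩ := isCompact_Icc.exists_bound_of_continuousOn M.continuousOn_h
  obtain ⟨K, hK⟩ := isCompact_Icc.exists_bound_of_continuousOn
    ((continuousOn_const (c := M.σ ^ 2 * M.κ)).mul M.continuousOn_h)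
  obtain ⟨r₀, hr₀, hmin⟩ := isCompact_Icc.exists_isMinOn (nonempty_Icc.2 hab.le)
    M.ρ_smooth.continuousOn
  have hρ₀ := M.ρ_pos r₀ hr₀
  have hhH : ∀ r ∈ Icc M.a M.b, M.h r ≤ H := fun r hr => (le_abs_self _).trans (hH r hr)
  refine ⟨M.κ * H + CL + K * (1 + H ^ 2) / 2, H ^ 2, ?_⟩
  -- Coercivity constant at least `1` for `J` is enough: the coupling loss is then bounded uniformly
  -- in `ζ`, which leaves the leading coefficient of `ζ²` in the estimate for `Φ` equal to `1`.
  have hlarge : ∀ᶠ ζ : ℝ in atTop, 1 ≤ ζ ^ 2 * M.ρ r₀ - M.σ ^ 2 * H - CJ := by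
    have ht : Tendsto (fun ζ : ℝ => ζ ^ 2 * M.ρ r₀) atTop atTop :=
      (tendsto_pow_atTop two_ne_zero).atTop_mul_const hρ₀
    filter_upwards [ht.eventually_ge_atTop (1 + M.σ ^ 2 * H + CJ)] with ζ hζ
    linarith
  filter_upwards [hlarge] with ζ hζ
  have hqJ : ∀ r ∈ Icc M.a M.b, M.qJ ζ r ≤ -(ζ ^ 2 * M.ρ r₀ - M.σ ^ 2 * H) := fun r hr => by
    rw [qJ_eq]
    have h1 := mul_le_mul_of_nonneg_left (hmin hr) (sq_nonneg ζ)
    have h2 := mul_le_mul_of_nonneg_left (hhH r hr) (sq_nonneg M.σ)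
    simp only at h1 ⊢
    linarith
  have hqL : ∀ r ∈ Icc M.a M.b, M.qL ζ r ≤ -(ζ ^ 2 - M.κ * H) := fun r hr => by
    have := mul_le_mul_of_nonneg_left (hhH r hr) M.κ_pos.le
    unfold qL
    linarith
  refine ⟨fun w z hw hwa hwb => ?_, fun S Φ Ψ η ξ hS hs => ?_⟩
  · have h1 := hCJ _ _ _ w z hw hqJ (M.continuousOn_qJ ζ) continuousOn_const hwa hwb
    simp only [Pi.zero_apply, zero_mul, intervalIntegral.integral_zero, neg_zero] at h1
    exact hw.eq_zero_of_integral_sq_nonpos hab (fun r hr => (M.pJ_pos r hr).ne')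
      (nonpos_of_mul_nonpos_right h1 (by linarith)) M.a ⟨le_rfl, hab.le⟩
  · have hΦ := hs.fst.continuousOn
    have hη := hs.snd.continuousOn
    have hk : ContinuousOn (fun r => M.σ ^ 2 * M.κ * M.h r) (Icc M.a M.b) :=
      continuousOn_const.mul M.continuousOn_h
    have h1 := hCL _ _ _ Φ Ψ hs.fst hqL (M.continuousOn_qL ζ) ((hk.mul hη).add hS) hs.fst_left
      hs.fst_right
    have h2 := hCJ _ _ _ η ξ hs.snd hqJ (M.continuousOn_qJ ζ) (M.continuousOn_h.mul hΦ)
      hs.snd_left hs.snd_right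
    have h3 := coupled_energy_le hab.le hζ hΦ hη hk M.continuousOn_h hS hK hH h1 h2
    rwa [show ζ ^ 2 - (M.κ * H + CL + K * (1 + H ^ 2) / 2) =
      ζ ^ 2 - M.κ * H - CL - K * (1 + H ^ 2) / 2 by ring]

end StellarModel

/-! ### The norm bound and the main theorem -/

theorem l2Norm_le_of_energy {a b m : ℝ} (hab : a ≤ b) (hm : 0 < m) {f w : ℝ → ℝ}
    (hf : ContinuousOn f (Icc a b)) (hw : ContinuousOn w (Icc a b))
    (h : m * ∫ r in a..b, w r ^ 2 ≤ -∫ r in a..b, f r * w r) :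
    l2Norm a b w ≤ m⁻¹ * l2Norm a b f := by
  rw [← div_eq_inv_mul, le_div_iff₀' hm, l2Norm, l2Norm]
  refine Real.le_sqrt_of_sq_le ?_
  rw [mul_pow, Real.sq_sqrt (intervalIntegral.integral_nonneg hab fun _ _ => sq_nonneg _)]
  exact sq_mul_integral_sq_le hab hm hf hw h

theorem mainTheorem8 (M : StellarModel) (hN : M.AdiabaticEquilibrium)
    (θ ϑ : ℝ × ℝ) (hθ : AdmissibleAngles θ) (hϑ : AdmissibleAngles ϑ) :
    ∃ ε : ℝ → ℝ, Tendsto ε atTop (𝓝 0) ∧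
      ∀ᶠ ζ : ℝ in atTop,
        ∃ G : ℝ → ℝ → ℝ, IsGreenFunction M.pJ (M.qJ ζ) M.a M.b ϑ G ∧
          ∀ η₀ ∈ M.kerJ ζ, ∃ Φ : ℝ → ℝ,
            M.IsSolution ζ G η₀ Φ ∧
            SLBoundary StellarModel.pL M.a M.b θ Φ ∧
            ContDiffOn ℝ 2 (M.etaP G Φ) (Icc M.a M.b) ∧
            (∀ r ∈ Icc M.a M.b, M.J ζ (M.etaP G Φ) r = M.h r * Φ r) ∧
            SLBoundary M.pJ M.a M.b ϑ (M.etaP G Φ) ∧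
            l2Norm M.a M.b Φ ≤ (ζ ^ 2)⁻¹ * (1 + ε ζ) * l2Norm M.a M.b (M.source η₀) := by
  have hab := M.a_lt_b
  obtain ⟨C, H, hev⟩ := M.exists_energy_constant θ ϑ
  have hsq : Tendsto (fun ζ : ℝ => ζ ^ 2) atTop atTop := tendsto_pow_atTop two_ne_zero
  -- Chosen so that `ζ⁻² (1 + ε ζ)` is exactly `(ζ² - C)⁻¹`.
  refine ⟨fun ζ => C / (ζ ^ 2 - C), (tendsto_atTop_add_const_right _ (-C) hsq).const_div_atTop C, ?_⟩
  have hpJ0 : ∀ r ∈ Icc M.a M.b, M.pJ r ≠ 0 := fun r hr => (M.pJ_pos r hr).ne'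
  have hpL0 : ∀ r ∈ Icc M.a M.b, StellarModel.pL r ≠ 0 := fun r hr => (M.pL_pos r hr).ne'
  have hpL : ContDiffOn ℝ 1 StellarModel.pL (Icc M.a M.b) := contDiffOn_id.pow 2
  have hk : ContinuousOn (fun r => M.σ ^ 2 * M.κ * M.h r) (Icc M.a M.b) :=
    continuousOn_const.mul M.continuousOn_h
  filter_upwards [hev, hsq.eventually_gt_atTop C, eventually_gt_atTop 0] with ζ ⟨hJ, hcoup⟩ hζC hζ0
  have hm : 0 < ζ ^ 2 - C := sub_pos.2 hζC
  have hqJ := M.continuousOn_qJ ζ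
  have hqL := M.continuousOn_qL ζ
  obtain ⟨u, zu, v, zv, huv⟩ :=
    exists_isAdaptedPair hab M.contDiffOn_pJ.continuousOn hpJ0 hqJ ϑ hJ
  refine ⟨greenKernel u v, huv.isGreenFunction hpJ0 M.contDiffOn_pJ hqJ, fun η₀ hη₀ => ?_⟩
  have hS : ContinuousOn (M.source η₀) (Icc M.a M.b) := hk.mul hη₀.1.continuousOn
  obtain ⟨Φ, Ψ, η, ξ, hs⟩ := exists_isCoupledSolution (S := M.source η₀) (θ := θ) (ϑ := ϑ) hab.le
    hpL.continuousOn hpL0 hqL M.contDiffOn_pJ.continuousOn hpJ0 hqJ hk M.continuousOn_h hS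
    -- With zero source the energy inequality forces `Φ = 0`, and the bound of `η` by `Φ` then gives
    -- `η = 0`.
    (fun Φ Ψ η ξ hs => by
      obtain ⟨h1, h2⟩ := hcoup 0 Φ Ψ η ξ continuousOn_const hs
      simp only [Pi.zero_apply, zero_mul, intervalIntegral.integral_zero, neg_zero] at h1
      have hΦ0 := nonpos_of_mul_nonpos_right h1 hm
      have hΦeq : ∫ r in M.a..M.b, Φ r ^ 2 = 0 :=
        le_antisymm hΦ0 (intervalIntegral.integral_nonneg hab.le fun _ _ => sq_nonneg _)
      rw [hΦeq, mul_zero] at h2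
      have ha : M.a ∈ Icc M.a M.b := ⟨le_rfl, hab.le⟩
      obtain ⟨e1, e2⟩ := hs.fst.eq_zero_of_integral_sq_nonpos hab hpL0 hΦ0 M.a ha
      obtain ⟨e3, e4⟩ := hs.snd.eq_zero_of_integral_sq_nonpos hab hpJ0 h2 M.a ha
      exact ⟨e1, e2, e3, e4⟩)
  have hΦ := hs.fst.continuousOn
  have hη := hs.snd.continuousOn
  have hfJ : ContinuousOn (fun r => M.h r * Φ r) (Icc M.a M.b) := M.continuousOn_h.mul hΦ
  -- Here the local system becomes the integro-differential equation: the second component is the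
  -- Green's operator applied to `hΦ`.
  have hEta : EqOn (M.etaP (greenKernel u v) Φ) η (Icc M.a M.b) := fun r hr =>
    huv.kernelOp_greenKernel_eq hs.snd hfJ hs.snd_left hs.snd_right hr
  have hpair := hs.snd.congr hEta
  refine ⟨Φ, ⟨hs.fst.contDiffOn_two hab hpL0 hpL hqL ((hk.mul hη).add hS), fun r hr => ?_⟩,
    hs.fst.slBoundary hab hpL0 hs.fst_left hs.fst_right,
    hpair.contDiffOn_two hab hpJ0 M.contDiffOn_pJ hqJ hfJ,
    fun r hr => hpair.slOp_eq hab hpJ0 hr, hpair.slBoundary hab hpJ0 ?_ ?_, ?_⟩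
  · rw [StellarModel.L, hs.fst.slOp_eq hab hpL0 hr, hEta hr]
  · rw [hEta ⟨le_rfl, hab.le⟩]
    exact hs.snd_left
  · rw [hEta ⟨hab.le, le_rfl⟩]
    exact hs.snd_right
  · have hζ2 : (ζ ^ 2)⁻¹ * (1 + C / (ζ ^ 2 - C)) = (ζ ^ 2 - C)⁻¹ := by
      field_simp
      ring
    rw [hζ2]
    exact l2Norm_le_of_energy hab.le hm hS hΦ (hcoup _ _ _ _ _ hS hs).1
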